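/- For $d \ge 1$ and $p \in [0,1]$, let $\mathbb{P}_p$ denote independent bond percolation on the nearest-neighbor graph of $\mathbb{Z}^d$: each edge is open with probability $p$ and closed with probability $1-p$, independently of the others. Call a vertex shielded if all edges incident to it are closed, and call an infinite path (a sequence of distinct vertices $x_0, x_1, x_2, \dots$ with $x_n$ adjacent to $x_{n+1}$ for all $n$) shielded if all its vertices are shielded. Set \[ p_{shield}(d) = \sup\{p \in [0,1] : \mathbb{P}_p(\text{there exists an infinite shielded path}) > 0\}. \] Then \[ p_{shield}(d) \sim \frac{\log d}{2d} \quad \text{as } d \to \infty, \] that is, $\lim_{d\to\infty} p_{shield}(d) \big/ \frac{\log d}{2d} = 1$. -/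

import Mathlib

open MeasureTheory ProbabilityTheory Filter Topology

/-- The nearest-neighbor graph of `ℤ^d`: two vertices are adjacent if and only if their
`ℓ¹`-distance is `1`. -/
def latticeGraph (d : ℕ) : SimpleGraph (Fin d → ℤ) where
  Adj x y := ∑ i, |x i - y i| = 1
  symm := ⟨fun x y h => by simpa only [abs_sub_comm] using h⟩
  loopless := ⟨fun x h => by simp at h⟩

/-- Bond configurations on `ℤ^d`: every nearest-neighbor edge is open (`true`) or closed
(`false`). -/
abbrev BondConfig (d : ℕ) : Type := (latticeGraph d).edgeSet → Bool

/-- The law of independent bond percolation on `ℤ^d` with parameter `p`: the edges are independent,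
and each is open with probability `p` and closed with probability `1 - p`. -/
noncomputable def bondPercolation (d : ℕ) (p : unitInterval) : Measure (BondConfig d) :=
  Measure.infinitePi fun _ => bernoulliMeasure true false p

/-- A vertex is shielded if all edges incident to it are closed. -/
def IsShielded {d : ℕ} (ω : BondConfig d) (x : Fin d → ℤ) : Prop :=
  ∀ e : (latticeGraph d).edgeSet, x ∈ (e : Sym2 (Fin d → ℤ)) → ω e = false

/-- An infinite shielded path: an infinite sequence of distinct shielded vertices, in which
consecutive vertices are adjacent in `ℤ^d`. -/
structure IsInfiniteShieldedPath {d : ℕ} (ω : BondConfig d) (γ : ℕ → Fin d → ℤ) : Prop where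
  injective : Function.Injective γ
  adj : ∀ n, (latticeGraph d).Adj (γ n) (γ (n + 1))
  shielded : ∀ n, IsShielded ω (γ n)

/-- The shielded critical probability: the supremum of the parameters `p ∈ [0, 1]` for which an
infinite shielded path exists with positive probability. -/
noncomputable def pShield (d : ℕ) : ℝ :=
  sSup {p : ℝ | ∃ hp : p ∈ Set.Icc (0 : ℝ) 1,
    0 < bondPercolation d ⟨p, hp⟩ {ω | ∃ γ, IsInfiniteShieldedPath ω γ}}

/-!
A vertex of `ℤ^d` is shielded with probability `(1 - p)^{2d}`, which is about `d^{-(1 ± ε)}` for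
`p = (1 ± ε) log d / (2d)`, and there are of order `2d` ways to continue a path. So the expected
number of shielded paths of length `n` decays exponentially above `log d / (2d)` and grows
exponentially below it. Two points need an argument: the shieldedness of different vertices is
dependent, since adjacent vertices share an edge, and a growing expectation has to be turned into
existence.

*Upper bound.* A shortest path in the graph of shielded vertices is an induced path of `ℤ^d`, so an
infinite shielded path forces induced shielded paths of every length from its starting point
(`exists_isInducedShieldedPath`). In an induced path only consecutive vertices share an edge, so
`n + 1` vertices have at least `(2d - 1)(n + 1)` incident edges (`le_card_biUnion_incidentEdges`).
The union bound over paths shows that there is no infinite shielded path if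
`2d (1 - p)^{2d - 1} < 1` (`bondPercolation_exists_path_eq_zero`).

*Lower bound.* The second moment method is applied to oriented paths, all of whose steps are
positive coordinate vectors; each path is weighted by the inverse of its probability. The second
moment is then the expectation of `(1 - p)^{-|E ∩ E'|}`, where `E` and `E'` are the sets of edges
incident to two independent uniform oriented paths. A common edge belongs to a meeting of the two
paths, or joins a vertex of one path to the next vertex of the other, so that the difference of
the two paths vanishes or is a difference of two coordinate vectors
(`pow_card_pathEdges_inter_le`). Hence the second moment is bounded by the expectation of a
product `∏ (1 + f(S_k))` along the difference walk `S`. By Khasminskii's lemma (`expProd_le_two`)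
this is bounded uniformly in the length as soon as the expected total of `f` along `S` is at most
`1/2` from every starting point.

That total is controlled by a uniform bound on the hitting probabilities of a point by an oriented
walk with `N` directions. After `k` steps they are at most `k! / N^k`, which is good for small `k`.
For large `k`, the directions are labelled by 8 bits: the numbers of steps with the different bits
equal to one are independent binomial variables determined by the endpoint, so that the hitting
probability is at most `(k + 1)^{-4}`. Together these give `1 / N` for `k = 1` and
`16 / (N k)^2` for `k ≥ 2` (`walkOp_pow_single_le_inv_sq`). A meeting costs a factor
`(1 - p)^{-(2d + 2)}`, about `d^{1 - ε}`, which is beaten by the sum of order `1 / d` of the meeting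
probabilities. Oriented shielded paths of length `n` from the origin thus exist with probability
bounded below uniformly in `n`, and compactness yields an infinite one.
-/

namespace ShieldedPercolation

/-! ### The lattice and its edges -/

section Lattice

variable {d : ℕ}

/-- The signed coordinate vector of `ℤ^d` in direction `c.1`; the sign is `+` if `c.2` is `true`. -/
def unitStep (c : Fin d × Bool) : Fin d → ℤ := Pi.single c.1 (if c.2 then 1 else -1)

lemma unitStep_injective : Function.Injective (unitStep (d := d)) := by
  rintro ⟨i, s⟩ ⟨j, t⟩ h
  have hij : i = j := by
    by_contra hij
    have := congrFun h i
    simp only [unitStep, Pi.single_eq_same, Pi.single_eq_of_ne hij] at this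
    grind
  subst hij
  have := congrFun h i
  simp only [unitStep, Pi.single_eq_same] at this
  cases s <;> cases t <;> simp_all

lemma adj_iff_exists_unitStep {x y : Fin d → ℤ} :
    (latticeGraph d).Adj x y ↔ ∃ c, y = x + unitStep c := by
  constructor
  · intro h
    change ∑ i, |x i - y i| = 1 at h
    obtain ⟨i, hi⟩ : ∃ i, x i ≠ y i := by
      by_contra! hc
      simp [hc] at h
    rw [← Finset.add_sum_erase _ _ (Finset.mem_univ i)] at h
    have h1 : 1 ≤ |x i - y i| := Int.one_le_abs (sub_ne_zero.2 hi)
    have h2 : 0 ≤ ∑ j ∈ Finset.univ.erase i, |x j - y j| :=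
      Finset.sum_nonneg fun _ _ => abs_nonneg _
    have h3 : ∀ j ≠ i, y j = x j := by
      intro j hj
      have := (Finset.sum_eq_zero_iff_of_nonneg (fun j _ => abs_nonneg (x j - y j))).1
        (by linarith : ∑ j ∈ Finset.univ.erase i, |x j - y j| = 0) j (by simp [hj])
      have := abs_eq_zero.1 this
      linarith
    have h4 : |x i - y i| = 1 := by linarith
    refine ⟨(i, decide (x i < y i)), ?_⟩
    ext j
    by_cases hj : j = i
    · subst hj
      rcases (abs_eq zero_le_one).1 h4 with h | h
      · have : ¬ x j < y j := by linarith
        simp only [unitStep, Pi.add_apply, Pi.single_eq_same, this, decide_false]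
        simp; linarith
      · have : x j < y j := by linarith
        simp only [unitStep, Pi.add_apply, Pi.single_eq_same, this, decide_true]
        simp; linarith
    · simp [unitStep, hj, h3 j hj]
  · rintro ⟨⟨i, s⟩, rfl⟩
    change ∑ j, |x j - (x + unitStep (i, s)) j| = 1
    rw [Finset.sum_eq_single i]
    · cases s <;> simp [unitStep]
    · intro j _ hj
      simp [unitStep, hj]
    · simp

/-- The `2d` edges incident to a vertex of `ℤ^d`. -/
noncomputable def incidentEdges (v : Fin d → ℤ) : Finset (latticeGraph d).edgeSet :=
  Finset.univ.map ⟨fun c => ⟨s(v, v + unitStep c), 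
      (SimpleGraph.mem_edgeSet _).2 (adj_iff_exists_unitStep.2 ⟨c, rfl⟩)⟩, by
    intro a b h
    exact unitStep_injective (add_left_cancel (Sym2.congr_right.1 (congrArg Subtype.val h)))⟩

lemma card_incidentEdges (v : Fin d → ℤ) : (incidentEdges v).card = 2 * d := by
  simp [incidentEdges, mul_comm]

lemma mem_incidentEdges {v : Fin d → ℤ} {e : (latticeGraph d).edgeSet} :
    e ∈ incidentEdges v ↔ v ∈ (e : Sym2 (Fin d → ℤ)) := by
  simp only [incidentEdges, Finset.mem_map, Finset.mem_univ, true_and]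
  constructor
  · rintro ⟨c, rfl⟩
    exact Sym2.mem_mk_left _ _
  · intro h
    obtain ⟨e, he⟩ := e
    obtain ⟨w, rfl⟩ := Sym2.mem_iff_exists.1 h
    obtain ⟨c, rfl⟩ := adj_iff_exists_unitStep.1 ((SimpleGraph.mem_edgeSet _).1 he)
    exact ⟨c, rfl⟩

/-! ### The probability that a set of edges is closed -/

/-- The event that all edges in `S` are closed. -/
def closedEvent (S : Finset (latticeGraph d).edgeSet) : Set (BondConfig d) :=
  {ω | ∀ e ∈ S, ω e = false}

lemma closedEvent_eq_pi (S : Finset (latticeGraph d).edgeSet) :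
    closedEvent S = Set.pi S fun _ => {false} := by
  ext ω; simp [closedEvent, Set.mem_pi]

lemma measurableSet_closedEvent (S : Finset (latticeGraph d).edgeSet) :
    MeasurableSet (closedEvent S) := by
  rw [closedEvent_eq_pi]
  exact MeasurableSet.pi S.countable_toSet fun _ _ => measurableSet_singleton _

instance (p : unitInterval) : IsProbabilityMeasure (bondPercolation d p) := by
  unfold bondPercolation; infer_instance

lemma bondPercolation_real_closedEvent (p : unitInterval) (S : Finset (latticeGraph d).edgeSet) :
    (bondPercolation d p).real (closedEvent S) = (1 - (p : ℝ)) ^ S.card := by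
  rw [closedEvent_eq_pi, measureReal_def, bondPercolation,
    Measure.infinitePi_pi _ (fun _ _ => measurableSet_singleton _), ENNReal.toReal_prod]
  simp

open Classical in
lemma forall_isShielded_iff {ω : BondConfig d} {s : Finset ℕ} {x : ℕ → Fin d → ℤ} :
    (∀ k ∈ s, IsShielded ω (x k)) ↔
      ω ∈ closedEvent (s.biUnion fun k => incidentEdges (x k)) := by
  simp only [closedEvent, Finset.mem_biUnion, mem_incidentEdges, Set.mem_ofPred_eq, IsShielded]
  exact ⟨fun h e ⟨k, hk, he⟩ => h k hk e he, fun h k hk e he => h e ⟨k, hk, he⟩⟩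

end Lattice

/-! ### Transition operators of random walks -/

section WalkOp

variable {δ V : Type*} [Fintype δ] [AddCommGroup V]

/-- The transition operator of the random walk on `V` whose steps are `s a`, with `a` uniform
on `δ`. -/
noncomputable def walkOp (s : δ → V) : Module.End ℝ (V → ℝ) where
  toFun g z := (Fintype.card δ : ℝ)⁻¹ * ∑ a, g (z + s a)
  map_add' g h := by ext z; simp [Finset.sum_add_distrib, mul_add]
  map_smul' c g := by ext z; simp [← Finset.mul_sum, mul_left_comm]

lemma walkOp_apply (s : δ → V) (g : V → ℝ) (z : V) :
    walkOp s g z = (Fintype.card δ : ℝ)⁻¹ * ∑ a, g (z + s a) := rfl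

lemma walkOp_commute {δ' : Type*} [Fintype δ'] (s : δ → V) (t : δ' → V) :
    Commute (walkOp s) (walkOp t) := by
  refine LinearMap.ext fun g => funext fun z => ?_
  simp only [Module.End.mul_apply, walkOp_apply, ← Finset.mul_sum]
  rw [Finset.sum_comm, mul_left_comm]
  simp only [add_right_comm]

/-- The difference of two independent walks with steps `s` is a walk with steps `s a - s b`. -/
lemma walkOp_sub (s : δ → V) :
    walkOp (fun q : δ × δ => s q.1 - s q.2) = walkOp (fun a => -s a) * walkOp s := by
  refine LinearMap.ext fun g => funext fun z => ?_
  simp only [Module.End.mul_apply, walkOp_apply, ← Finset.mul_sum, Fintype.sum_prod_type,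
    Fintype.card_prod, Nat.cast_mul, mul_inv]
  rw [Finset.sum_comm, mul_assoc]
  refine congrArg _ (congrArg _ (Finset.sum_congr rfl fun a _ =>
    Finset.sum_congr rfl fun b _ => ?_))
  congr 1
  abel

lemma walkOp_mono (s : δ → V) {g h : V → ℝ} (hgh : g ≤ h) : walkOp s g ≤ walkOp s h := fun z => by
  simp only [walkOp_apply]
  exact mul_le_mul_of_nonneg_left (Finset.sum_le_sum fun a _ => hgh _) (by positivity)

lemma walkOp_pow_mono (s : δ → V) (k : ℕ) {g h : V → ℝ} (hgh : g ≤ h) :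
    (walkOp s ^ k) g ≤ (walkOp s ^ k) h := by
  induction k with
  | zero => simpa using hgh
  | succ k ih =>
    rw [pow_succ', Module.End.mul_apply, Module.End.mul_apply]
    exact walkOp_mono s ih

variable [Nonempty δ]

lemma walkOp_const (s : δ → V) (c : ℝ) : walkOp s (fun _ => c) = fun _ => c := by
  ext z
  simp [walkOp_apply]

lemma walkOp_pow_const (s : δ → V) (k : ℕ) (c : ℝ) : (walkOp s ^ k) (fun _ => c) = fun _ => c := by
  induction k with
  | zero => simp
  | succ k ih => rw [pow_succ', Module.End.mul_apply, ih, walkOp_const]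

/-- `expProd s f n z` is the expectation of `∏_{k=1}^n (1 + f(S_k))` for the random walk `S` with
steps `s` started at `z`. -/
noncomputable def expProd (s : δ → V) (f : V → ℝ) : ℕ → V → ℝ
  | 0 => fun _ => 1
  | n + 1 => walkOp s (fun z => (1 + f z) * expProd s f n z)

lemma expProd_eq_one_add_sum (s : δ → V) (f : V → ℝ) (n : ℕ) :
    expProd s f n = (fun _ => 1) + ∑ k ∈ Finset.range n,
      (walkOp s ^ (k + 1)) (fun z => f z * expProd s f (n - 1 - k) z) := by
  induction n with
  | zero => simp [expProd]
  | succ n ih =>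
    have h : (fun z => (1 + f z) * expProd s f n z) =
        expProd s f n + fun z => f z * expProd s f n z := by ext z; simp; ring
    rw [expProd, h, map_add, Finset.sum_range_succ']
    conv_lhs => arg 1; rw [ih]
    rw [map_add, walkOp_const, map_sum, add_assoc]
    congr 2
    refine Finset.sum_congr rfl fun k _ => ?_
    rw [← Module.End.mul_apply, ← pow_succ', Nat.add_sub_cancel, Nat.sub_sub, add_comm k 1]

/-- **Khasminskii's lemma**: if the expected total of `f` along the walk is at most `1/2`, whatever
the starting point, then the expectation of `∏ (1 + f(S_k))` is at most `2`. -/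
lemma expProd_le_two (s : δ → V) {f : V → ℝ} (hf : 0 ≤ f)
    (h : ∀ n z, ∑ k ∈ Finset.range n, (walkOp s ^ (k + 1)) f z ≤ 1 / 2) (n : ℕ) (z : V) :
    expProd s f n z ≤ 2 := by
  induction n using Nat.strong_induction_on generalizing z with
  | _ n ih =>
    have hle : ∀ k ∈ Finset.range n, (walkOp s ^ (k + 1))
        (fun z => f z * expProd s f (n - 1 - k) z) z ≤ 2 * (walkOp s ^ (k + 1)) f z := by
      intro k hk
      have hk := Finset.mem_range.1 hk
      have := walkOp_pow_mono s (k + 1) (g := fun z => f z * expProd s f (n - 1 - k) z)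
        (h := (2 : ℝ) • f) (fun y => by
          have := mul_le_mul_of_nonneg_left (ih (n - 1 - k) (by omega) y) (hf y)
          simpa [mul_comm] using this) z
      simpa using this
    rw [expProd_eq_one_add_sum, Pi.add_apply, Finset.sum_apply]
    have := Finset.sum_le_sum hle
    rw [← Finset.mul_sum] at this
    linarith [h n z]

end WalkOp

/-! ### Return probabilities of the oriented walk -/

/-- The probability `C(k, u) / 2^k` that a sum of `k` independent fair bits equals `u`. -/
noncomputable def fairBits (k : ℕ) : ℤ → ℝ
  | Int.ofNat u => (k.choose u : ℝ) / 2 ^ k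
  | Int.negSucc _ => 0

lemma fairBits_nonneg (k : ℕ) (u : ℤ) : 0 ≤ fairBits k u := by
  cases u <;> simp only [fairBits] <;> positivity

lemma fairBits_zero_zero : fairBits 0 0 = 1 := by
  change ((Nat.choose 0 0 : ℕ) : ℝ) / 2 ^ 0 = 1
  simp

lemma fairBits_succ (k : ℕ) (u : ℤ) :
    fairBits (k + 1) u = (fairBits k u + fairBits k (u - 1)) / 2 := by
  rcases u with (_ | u) | u
  · have : Int.ofNat 0 - 1 = Int.negSucc 0 := rfl
    rw [this]
    simp only [fairBits, Nat.choose_zero_right]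
    field_simp
    ring
  · have : Int.ofNat (u + 1) - 1 = Int.ofNat u := by simp
    rw [this]
    simp only [fairBits, Nat.choose_succ_succ']
    push_cast
    field_simp
    ring
  · have : Int.negSucc u - 1 = Int.negSucc (u + 1) := rfl
    rw [this]
    simp [fairBits]

lemma two_mul_add_one_mul_centralBinom_sq_le (n : ℕ) :
    (2 * n + 1) * n.centralBinom ^ 2 ≤ 16 ^ n := by
  induction n with
  | zero => simp
  | succ n ih =>
    have h := Nat.succ_mul_centralBinom_succ n
    have h2 : (n + 1) ^ 2 * ((2 * (n + 1) + 1) * (n + 1).centralBinom ^ 2) ≤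
        (n + 1) ^ 2 * 16 ^ (n + 1) := by
      calc _ = (2 * n + 3) * ((n + 1) * (n + 1).centralBinom) ^ 2 := by ring
        _ = 4 * ((2 * n + 3) * (2 * n + 1)) * ((2 * n + 1) * n.centralBinom ^ 2) := by rw [h]; ring
        _ ≤ 4 * (4 * (n + 1) ^ 2) * 16 ^ n := by
          refine Nat.mul_le_mul (Nat.mul_le_mul_left 4 ?_) ih
          nlinarith
        _ = _ := by ring
    exact Nat.le_of_mul_le_mul_left h2 (by positivity)

lemma succ_mul_choose_sq_le (k u : ℕ) : (k + 1) * k.choose u ^ 2 ≤ 4 ^ k := by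
  obtain ⟨n, rfl | rfl⟩ := Nat.even_or_odd' k
  · calc _ ≤ (2 * n + 1) * n.centralBinom ^ 2 := by
          gcongr; exact Nat.choose_le_centralBinom u n
      _ ≤ 16 ^ n := two_mul_add_one_mul_centralBinom_sq_le n
      _ = _ := by rw [pow_mul]; norm_num
  · have h1 : 2 * (2 * n + 1).choose u ≤ (n + 1).centralBinom := by
      have h := Nat.choose_le_middle u (2 * n + 1)
      rw [show (2 * n + 1) / 2 = n by omega] at h
      have h2 : (n + 1).centralBinom = (2 * n + 1).choose n + (2 * n + 1).choose (n + 1) := by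
        rw [Nat.centralBinom_eq_two_mul_choose, show 2 * (n + 1) = 2 * n + 1 + 1 by ring,
          Nat.choose_succ_succ']
      rw [h2, Nat.choose_symm_half]
      omega
    have h3 := two_mul_add_one_mul_centralBinom_sq_le (n + 1)
    have h4 : (2 * (2 * n + 1).choose u) ^ 2 ≤ (n + 1).centralBinom ^ 2 := by gcongr
    have h5 : (16 : ℕ) ^ (n + 1) = 4 * 4 ^ (2 * n + 1) := by
      rw [show (16 : ℕ) = 4 ^ 2 by norm_num, ← pow_mul, ← pow_succ']
      congr 1
    nlinarith

lemma fairBits_sq_le (k : ℕ) (u : ℤ) : fairBits k u ^ 2 ≤ ((k : ℝ) + 1)⁻¹ := by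
  rcases u with u | u
  · simp only [fairBits]
    rw [div_pow, ← pow_mul, mul_comm k, pow_mul, ← one_div, div_le_div_iff₀ (by positivity)
      (by positivity)]
    have : ((k : ℝ) + 1) * (k.choose u : ℝ) ^ 2 ≤ 4 ^ k := mod_cast succ_mul_choose_sq_le k u
    norm_num
    linarith
  · rw [fairBits, zero_pow two_ne_zero]
    positivity

section OrientedWalk

variable {d : ℕ} {δ : Type*} [Fintype δ]

/-- The positive coordinate vector of `ℤ^d` attached to `a` by the embedding `ι` of a set `δ` of
directions into the coordinates. -/
def orientedStep (ι : δ ↪ Fin d) (a : δ) : Fin d → ℤ := Pi.single (ι a) 1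

lemma walkOp_pow_single_nonneg (s : δ → Fin d → ℤ) (k : ℕ) (r z : Fin d → ℤ) :
    0 ≤ (walkOp s ^ k) (Pi.single r 1) z := by
  have h := walkOp_pow_mono s k (g := 0) (h := Pi.single r 1)
    (Pi.single_nonneg.2 zero_le_one) z
  simpa using h

lemma le_of_walkOp_pow_single_ne_zero (ι : δ ↪ Fin d) {k : ℕ} {r z : Fin d → ℤ}
    (h : (walkOp (orientedStep ι) ^ k) (Pi.single r 1) z ≠ 0) :
    z ≤ r ∧ ∑ i, (r i - z i) = k := by
  induction k generalizing z with
  | zero =>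
    have : z = r := by
      by_contra hz
      simp [hz] at h
    simp [this]
  | succ k ih =>
    rw [pow_succ', Module.End.mul_apply, walkOp_apply] at h
    obtain ⟨a, -, ha⟩ := Finset.exists_ne_zero_of_sum_ne_zero (right_ne_zero_of_mul h)
    obtain ⟨h1, h2⟩ := ih ha
    constructor
    · refine le_trans ?_ h1
      simp [orientedStep]
    · simp only [Pi.add_apply, orientedStep, ← sub_sub] at h2
      rw [Finset.sum_sub_distrib, Finset.sum_pi_single'] at h2
      simp at h2 ⊢
      linarith

/-- A position reached in `k` steps is reached along at most `k!` sequences of directions. -/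
lemma walkOp_pow_single_le_factorial (ι : δ ↪ Fin d) (k : ℕ) (r z : Fin d → ℤ) :
    (walkOp (orientedStep ι) ^ k) (Pi.single r 1) z ≤
      (k.factorial : ℝ) / (Fintype.card δ : ℝ) ^ k := by
  classical
  induction k generalizing z with
  | zero =>
    by_cases hz : z = r <;> simp [hz]
  | succ k ih =>
    rw [pow_succ', Module.End.mul_apply, walkOp_apply]
    set g := (walkOp (orientedStep ι) ^ k) (Pi.single r 1) with hg
    set A := Finset.univ.filter fun a => g (z + orientedStep ι a) ≠ 0 with hA
    have hsum : ∑ a, g (z + orientedStep ι a) = ∑ a ∈ A, g (z + orientedStep ι a) :=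
      (Finset.sum_filter_ne_zero _).symm
    have hcard : (A.card : ℤ) ≤ k + 1 := by
      rcases A.eq_empty_or_nonempty with h | ⟨b, hb⟩
      · simp [h]; positivity
      -- `r - z` is nonnegative with coordinate sum `k + 1`, and positive in each usable direction.
      have hmem : ∀ a ∈ A, z + orientedStep ι a ≤ r ∧
          ∑ i, (r i - (z + orientedStep ι a) i) = k := fun a ha =>
        le_of_walkOp_pow_single_ne_zero ι (Finset.mem_filter.1 ha).2
      have hz : ∀ i, 0 ≤ r i - z i := by
        intro i
        have := (hmem b hb).1 i
        have h0 : 0 ≤ orientedStep ι b i := by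
          simp only [orientedStep, Pi.single_apply]; split_ifs <;> simp
        simp only [Pi.add_apply] at this
        linarith
      have htot : ∑ i, (r i - z i) = k + 1 := by
        have h2 := (hmem b hb).2
        simp only [Pi.add_apply, orientedStep, ← sub_sub] at h2
        rw [Finset.sum_sub_distrib, Finset.sum_pi_single'] at h2
        simp at h2 ⊢
        linarith
      calc (A.card : ℤ) = ∑ a ∈ A, 1 := by simp
        _ ≤ ∑ a ∈ A, (r (ι a) - z (ι a)) := Finset.sum_le_sum fun a ha => by
            have := (hmem a ha).1 (ι a)
            simp [orientedStep] at this
            linarith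
        _ = ∑ i ∈ A.map ι, (r i - z i) := by simp
        _ ≤ ∑ i, (r i - z i) :=
            Finset.sum_le_sum_of_subset_of_nonneg (Finset.subset_univ _) fun i _ _ => hz i
        _ = k + 1 := htot
    have hcard' : (A.card : ℝ) ≤ k + 1 := mod_cast hcard
    calc (Fintype.card δ : ℝ)⁻¹ * ∑ a, g (z + orientedStep ι a)
        ≤ (Fintype.card δ : ℝ)⁻¹ * (A.card • ((k.factorial : ℝ) / (Fintype.card δ : ℝ) ^ k)) := by
          rw [hsum]
          gcongr
          exact Finset.sum_le_card_nsmul _ _ _ fun a _ => ih _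
      _ ≤ (Fintype.card δ : ℝ)⁻¹ * ((k + 1) * ((k.factorial : ℝ) / (Fintype.card δ : ℝ) ^ k)) := by
          rw [nsmul_eq_mul]
          gcongr
      _ = _ := by
          rw [Nat.factorial_succ, pow_succ']
          push_cast
          rw [div_eq_mul_inv, div_eq_mul_inv, mul_inv]
          ring

variable {D m : ℕ}

/-- The projection of `ℤ^d` whose `j`-th coordinate adds up the coordinates attached to the
directions with `j`-th bit `true`. -/
def bitSum (ι : Fin D × (Fin m → Bool) ↪ Fin d) (j : Fin m) (z : Fin d → ℤ) : ℤ :=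
  ∑ a, if a.2 j then z (ι a) else 0

lemma bitSum_sub_orientedStep (ι : Fin D × (Fin m → Bool) ↪ Fin d) (j : Fin m) (z : Fin d → ℤ)
    (a : Fin D × (Fin m → Bool)) :
    bitSum ι j (z - orientedStep ι a) = bitSum ι j z - (a.2 j).toInt := by
  have h : ∀ b, (if b.2 j then (z - orientedStep ι a) (ι b) else 0) =
      (if b.2 j then z (ι b) else 0) - if b = a then (a.2 j).toInt else 0 := by
    intro b
    by_cases hb : b = a
    · subst hb
      by_cases hj : b.2 j <;> simp [hj, orientedStep]
    · simp [orientedStep, hb]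
  simp only [bitSum, h, Finset.sum_sub_distrib, Finset.sum_ite_eq', Finset.mem_univ, if_true]

/-- The bits of the directions are independent and fair, so their numbers of occurrences are
independent binomial variables, determined by the position of the walk. -/
lemma walkOp_pow_single_le_prod_fairBits [NeZero D] (ι : Fin D × (Fin m → Bool) ↪ Fin d) (k : ℕ)
    (r z : Fin d → ℤ) :
    (walkOp (orientedStep ι) ^ k) (Pi.single r 1) z ≤ ∏ j, fairBits k (bitSum ι j (r - z)) := by
  induction k generalizing z with
  | zero =>
    by_cases hz : z = r
    · simp [hz, bitSum, fairBits_zero_zero]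
    · simpa [hz] using Finset.prod_nonneg fun j _ => fairBits_nonneg 0 (bitSum ι j (r - z))
  | succ k ih =>
    rw [pow_succ', Module.End.mul_apply]
    refine (walkOp_mono (orientedStep ι) (h := fun y => ∏ j, fairBits k (bitSum ι j (r - y)))
      (fun y => ih y) z).trans_eq ?_
    rw [walkOp_apply]
    have hbool : ∀ j, fairBits (k + 1) (bitSum ι j (r - z)) =
        ∑ b : Bool, fairBits k (bitSum ι j (r - z) - b.toInt) / 2 := by
      intro j
      rw [fairBits_succ]
      simp
      ring
    simp only [hbool, Finset.prod_univ_sum, Fintype.piFinset_univ, Fintype.sum_prod_type,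
      ← sub_sub, bitSum_sub_orientedStep, Finset.prod_div_distrib]
    have hD : (D : ℝ) ≠ 0 := Nat.cast_ne_zero.2 (NeZero.ne D)
    rw [Finset.sum_const, ← Finset.sum_div]
    simp
    field_simp

lemma walkOp_pow_single_le_inv_pow [NeZero D] (ι : Fin D × (Fin 8 → Bool) ↪ Fin d) (k : ℕ)
    (r z : Fin d → ℤ) :
    (walkOp (orientedStep ι) ^ k) (Pi.single r 1) z ≤ (((k : ℝ) + 1) ^ 4)⁻¹ := by
  refine (walkOp_pow_single_le_prod_fairBits ι k r z).trans
    (abs_le_of_sq_le_sq' ?_ (by positivity)).2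
  rw [← Finset.prod_pow]
  calc _ ≤ ∏ _j : Fin 8, ((k : ℝ) + 1)⁻¹ :=
        Finset.prod_le_prod (fun _ _ => sq_nonneg _) fun _ _ => fairBits_sq_le _ _
    _ = _ := by
      rw [Finset.prod_const, Finset.card_univ, Fintype.card_fin, inv_pow, inv_pow, ← pow_mul]

lemma walkOp_pow_single_antitone [Nonempty δ] (ι : δ ↪ Fin d) {k l : ℕ} (hkl : k ≤ l) {c : ℝ}
    {r : Fin d → ℤ} (h : ∀ z, (walkOp (orientedStep ι) ^ k) (Pi.single r 1) z ≤ c)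
    (z : Fin d → ℤ) : (walkOp (orientedStep ι) ^ l) (Pi.single r 1) z ≤ c := by
  obtain ⟨m, rfl⟩ := Nat.exists_eq_add_of_le' hkl
  rw [pow_add, Module.End.mul_apply]
  exact (walkOp_pow_mono (orientedStep ι) m (h := fun _ => c) h z).trans_eq
    (congrFun (walkOp_pow_const _ _ _) z)

/-- A summable bound for the hitting probabilities: for few steps the bound `k! / N^k` is used, for
many steps the geometric mean of `4! / N^4` and the diffusive bound `(k + 1)^{-4}`. -/
lemma walkOp_pow_single_le_inv_sq [NeZero D] (ι : Fin D × (Fin 8 → Bool) ↪ Fin d) {k : ℕ}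
    (hk : 2 ≤ k) (r z : Fin d → ℤ) :
    (walkOp (orientedStep ι) ^ k) (Pi.single r 1) z ≤
      16 / (256 * D : ℝ) ^ 2 * ((k : ℝ) ^ 2)⁻¹ := by
  have hN : (Fintype.card (Fin D × (Fin 8 → Bool)) : ℝ) = 256 * D := by simp; ring
  have hD : (1 : ℝ) ≤ D := mod_cast NeZero.one_le
  set N : ℝ := 256 * D with hNdef
  have hN4 : 4 ≤ N := by linarith
  have hf := fun k => walkOp_pow_single_le_factorial ι k r
  simp only [hN] at hf
  obtain rfl | rfl | hk4 : k = 2 ∨ k = 3 ∨ 4 ≤ k := by omega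
  · refine (hf 2 z).trans ?_
    rw [div_mul_eq_mul_div]
    gcongr
    norm_num
  · refine (hf 3 z).trans ?_
    rw [div_mul_eq_mul_div, div_le_div_iff₀ (by positivity) (by positivity)]
    norm_num [Nat.factorial]
    have : 0 < N ^ 2 := by positivity
    nlinarith
  · have h1 := walkOp_pow_single_antitone ι hk4 (hf 4) z
    have h2 : (walkOp (orientedStep ι) ^ k) (Pi.single r 1) z ≤ ((k : ℝ) ^ 4)⁻¹ :=
      (walkOp_pow_single_le_inv_pow ι k r z).trans (by gcongr; linarith)
    have h0 := walkOp_pow_single_nonneg (orientedStep ι) k r z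
    refine (abs_le_of_sq_le_sq' ?_ (by positivity)).2
    rw [sq]
    refine (mul_le_mul h1 h2 h0 (by positivity)).trans ?_
    have h3 : (16 / N ^ 2 * ((k : ℝ) ^ 2)⁻¹) ^ 2 = 256 / N ^ 4 * ((k : ℝ) ^ 4)⁻¹ := by
      rw [mul_pow, div_pow, inv_pow, ← pow_mul, ← pow_mul]
      norm_num
    rw [h3]
    gcongr
    norm_num [Nat.factorial]

end OrientedWalk

/-! ### The overlap of two independent oriented walks -/

section Overlap

variable {d D : ℕ}

lemma sum_inv_sq_le_one (n : ℕ) :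
    ∑ k ∈ Finset.range n, (((k + 1 + 1 : ℕ) : ℝ) ^ 2)⁻¹ ≤ 1 := by
  have h : ∑ k ∈ Finset.range n, (((k + 1 + 1 : ℕ) : ℝ) ^ 2)⁻¹ ≤ 1 - ((n : ℝ) + 1)⁻¹ := by
    induction n with
    | zero => simp
    | succ n ih =>
      rw [Finset.sum_range_succ]
      have : (((n + 1 + 1 : ℕ) : ℝ) ^ 2)⁻¹ ≤ ((n : ℝ) + 1)⁻¹ - ((n : ℝ) + 1 + 1)⁻¹ := by
        rw [inv_sub_inv (by positivity) (by positivity), inv_eq_one_div, div_le_div_iff₀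
          (by positivity) (by positivity)]
        push_cast
        nlinarith [(Nat.cast_nonneg n : (0 : ℝ) ≤ n)]
      push_cast at this ih ⊢
      linarith
  have : (0 : ℝ) ≤ ((n : ℝ) + 1)⁻¹ := by positivity
  linarith

open Classical in
/-- The weight of the difference `z` of two oriented walks at a given time: `a` if the walks meet,
and `c` if one walk is at a neighbor of a possible next position of the other, that is, if `z` is
a difference of two coordinate vectors. -/
noncomputable def overlapWeight (a c : ℝ) (z : Fin d → ℤ) : ℝ :=
  (if z = 0 then a else 0) +
    if ∃ i j : Fin d, z = Pi.single i 1 - Pi.single j 1 then c else 0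

lemma overlapWeight_nonneg {a c : ℝ} (ha : 0 ≤ a) (hc : 0 ≤ c) :
    0 ≤ overlapWeight (d := d) a c := fun z => by
  unfold overlapWeight
  positivity

lemma overlapWeight_le_add_const {a c : ℝ} (hc : 0 ≤ c) :
    overlapWeight (d := d) a c ≤ a • Pi.single 0 1 + fun _ => c := fun z => by
  simp only [overlapWeight, Pi.add_apply, Pi.smul_apply, Pi.single_apply, smul_eq_mul, mul_ite,
    mul_one, mul_zero]
  gcongr
  split_ifs <;> simp [hc]

lemma overlapWeight_le_add_sum {a c : ℝ} (hc : 0 ≤ c) :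
    overlapWeight (d := d) a c ≤ a • Pi.single 0 1 +
      c • ∑ q : Fin d × Fin d, Pi.single (Pi.single q.1 1 - Pi.single q.2 1) 1 := fun z => by
  simp only [overlapWeight, Pi.add_apply, Pi.smul_apply, Pi.single_apply, smul_eq_mul, mul_ite,
    mul_one, mul_zero, Finset.sum_apply]
  gcongr
  have h0 : ∀ q ∈ (Finset.univ : Finset (Fin d × Fin d)),
      (0 : ℝ) ≤ if z = Pi.single q.1 1 - Pi.single q.2 1 then 1 else 0 := fun q _ => by positivity
  split_ifs with h
  · obtain ⟨i, j, hij⟩ := h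
    have := Finset.single_le_sum h0 (Finset.mem_univ (i, j))
    rw [if_pos hij] at this
    nlinarith
  · exact mul_nonneg hc (Finset.sum_nonneg h0)

/-- The transition operator of the difference of two independent oriented walks. -/
noncomputable def diffOp {δ : Type*} [Fintype δ] (ι : δ ↪ Fin d) :
    Module.End ℝ ((Fin d → ℤ) → ℝ) :=
  walkOp fun q : δ × δ => orientedStep ι q.1 - orientedStep ι q.2

/-- Conditionally on one of the walks, a hitting probability of the difference walk is a hitting
probability of the other walk. -/
lemma diffOp_pow_single_le {δ : Type*} [Fintype δ] [Nonempty δ] (ι : δ ↪ Fin d) {k : ℕ} {b : ℝ}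
    {r : Fin d → ℤ} (h : ∀ z, (walkOp (orientedStep ι) ^ k) (Pi.single r 1) z ≤ b)
    (z : Fin d → ℤ) : (diffOp ι ^ k) (Pi.single r 1) z ≤ b := by
  rw [diffOp, walkOp_sub, (walkOp_commute _ _).mul_pow, Module.End.mul_apply]
  exact (walkOp_pow_mono _ k (h := fun _ => b) h z).trans_eq (congrFun (walkOp_pow_const _ _ _) z)

variable [NeZero D] (ι : Fin D × (Fin 8 → Bool) ↪ Fin d)

/-- The first step contributes at most `a / N + c`, where `N = 256 D` is the number of directions;
later steps are bounded by hitting the origin or one of at most `d ^ 2` differences of coordinate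
vectors. -/
lemma sum_diffOp_pow_overlapWeight_le {a c : ℝ} (ha : 0 ≤ a) (hc : 0 ≤ c) (n : ℕ)
    (z : Fin d → ℤ) :
    ∑ k ∈ Finset.range n, (diffOp ι ^ (k + 1)) (overlapWeight a c) z ≤
      a / (256 * D) + c + 16 * (a + c * d ^ 2) / (256 * D : ℝ) ^ 2 := by
  rcases n with _ | n
  · rw [Finset.sum_range_zero]; positivity
  have hN : (Fintype.card (Fin D × (Fin 8 → Bool)) : ℝ) = 256 * D := by simp; ring
  have h1 : (diffOp ι ^ 1) (overlapWeight a c) z ≤ a / (256 * D) + c := by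
    refine (walkOp_pow_mono _ 1 (overlapWeight_le_add_const hc) z).trans ?_
    rw [map_add, map_smul, walkOp_pow_const, Pi.add_apply, Pi.smul_apply, smul_eq_mul,
      div_eq_mul_inv]
    gcongr
    refine diffOp_pow_single_le ι (k := 1) (fun z => ?_) z
    have := walkOp_pow_single_le_factorial ι 1 0 z
    rw [hN] at this
    simpa using this
  have h2 : ∀ k ∈ Finset.range n, (diffOp ι ^ (k + 1 + 1)) (overlapWeight a c) z ≤
      16 * (a + c * d ^ 2) / (256 * D : ℝ) ^ 2 * (((k + 1 + 1 : ℕ) : ℝ) ^ 2)⁻¹ := by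
    intro k _
    have hq : ∀ r, (diffOp ι ^ (k + 1 + 1)) (Pi.single r 1) z ≤
        16 / (256 * D : ℝ) ^ 2 * (((k + 1 + 1 : ℕ) : ℝ) ^ 2)⁻¹ := fun r =>
      diffOp_pow_single_le ι (fun z => walkOp_pow_single_le_inv_sq ι (by omega) r z) z
    refine (walkOp_pow_mono _ (k + 1 + 1) (overlapWeight_le_add_sum hc) z).trans ?_
    rw [map_add, map_smul, map_smul, map_sum, Pi.add_apply, Pi.smul_apply, Pi.smul_apply,
      Finset.sum_apply, smul_eq_mul, smul_eq_mul]
    have hs := Finset.sum_le_card_nsmul (Finset.univ : Finset (Fin d × Fin d)) _ _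
      fun q _ => hq (Pi.single q.1 1 - Pi.single q.2 1)
    refine (add_le_add (mul_le_mul_of_nonneg_left (hq 0) ha)
      (mul_le_mul_of_nonneg_left hs hc)).trans_eq ?_
    simp
    ring
  rw [Finset.sum_range_succ']
  have h3 := Finset.sum_le_sum h2
  rw [← Finset.mul_sum] at h3
  have h4 := mul_le_mul_of_nonneg_left (sum_inv_sq_le_one n)
    (by positivity : 0 ≤ 16 * (a + c * d ^ 2) / (256 * D : ℝ) ^ 2)
  linarith

end Overlap

section Positions

variable {d n : ℕ} {δ : Type*}

/-- The position after `k` steps of the walk with steps `s`, started at `0`, whose `n` directions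
are `σ`; it is constant for `k ≥ n`. -/
def walkPos (s : δ → Fin d → ℤ) (σ : Fin n → δ) (k : ℕ) : Fin d → ℤ :=
  ∑ i : Fin n, if (i : ℕ) < k then s (σ i) else 0

@[simp] lemma walkPos_zero (s : δ → Fin d → ℤ) (σ : Fin n → δ) : walkPos s σ 0 = 0 := by
  simp [walkPos]

lemma walkPos_succ (s : δ → Fin d → ℤ) (σ : Fin n → δ) {k : ℕ} (hk : k < n) :
    walkPos s σ (k + 1) = walkPos s σ k + s (σ ⟨k, hk⟩) := by
  have h : ∀ i : Fin n, (if (i : ℕ) < k + 1 then s (σ i) else 0) =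
      (if (i : ℕ) < k then s (σ i) else 0) + if i = ⟨k, hk⟩ then s (σ i) else 0 := by
    intro i
    rcases lt_trichotomy (i : ℕ) k with h | h | h
    · simp [h, h.trans (Nat.lt_succ_self k), Fin.ext_iff, h.ne]
    · simp [h, Fin.ext_iff]
    · simp [h.not_ge, h.not_gt, Fin.ext_iff, h.ne']
  simp only [walkPos, h, Finset.sum_add_distrib, Finset.sum_ite_eq', Finset.mem_univ, if_true]

lemma walkPos_cons (s : δ → Fin d → ℤ) (a : δ) (σ : Fin n → δ) (k : ℕ) :
    walkPos s (Fin.cons a σ : Fin (n + 1) → δ) (k + 1) = s a + walkPos s σ k := by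
  simp [walkPos, Fin.sum_univ_succ]

lemma sum_walkPos (ι : δ ↪ Fin d) (σ : Fin n → δ) {k : ℕ} (hk : k ≤ n) :
    ∑ i, walkPos (orientedStep ι) σ k i = k := by
  induction k with
  | zero => simp
  | succ k ih =>
    rw [walkPos_succ _ σ hk]
    simp [Finset.sum_add_distrib, ih (Nat.le_of_succ_le hk), orientedStep]

variable [Fintype δ] [Nonempty δ]

lemma sum_sum_prod_eq_expProd (s : δ → Fin d → ℤ) (f : (Fin d → ℤ) → ℝ) (n : ℕ)
    (x : Fin d → ℤ) :
    ∑ σ : Fin n → δ, ∑ τ : Fin n → δ, ∏ k ∈ Finset.range (n + 1),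
        (1 + f (x + (walkPos s σ k - walkPos s τ k))) =
      (Fintype.card δ : ℝ) ^ (2 * n) * ((1 + f x) *
        expProd (fun q : δ × δ => s q.1 - s q.2) f n x) := by
  induction n generalizing x with
  | zero => simp [expProd]
  | succ n ih =>
    have hcons : ∀ G : (Fin (n + 1) → δ) → ℝ, ∑ σ, G σ = ∑ a, ∑ σ, G (Fin.cons a σ) := by
      intro G
      rw [← Fintype.sum_prod_type']
      exact (Fintype.sum_equiv (Fin.consEquiv fun _ => δ) _ _ fun _ => rfl).symm
    have hstep : ∀ (a b : δ) (σ τ : Fin n → δ),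
        ∏ k ∈ Finset.range (n + 1 + 1), (1 + f (x + (walkPos s (Fin.cons a σ) k -
          walkPos s (Fin.cons b τ) k))) =
        (∏ k ∈ Finset.range (n + 1), (1 + f (x + (s a - s b) +
          (walkPos s σ k - walkPos s τ k)))) * (1 + f x) := by
      intro a b σ τ
      rw [Finset.prod_range_succ']
      congr 1
      · refine Finset.prod_congr rfl fun k _ => ?_
        rw [walkPos_cons, walkPos_cons]
        congr 2
        abel
      · simp
    have hcard : (Fintype.card δ : ℝ) ≠ 0 := Nat.cast_ne_zero.2 Fintype.card_ne_zero
    calc _ = ∑ a, ∑ b, ∑ σ : Fin n → δ, ∑ τ : Fin n → δ,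
          (∏ k ∈ Finset.range (n + 1), (1 + f (x + (s a - s b) +
            (walkPos s σ k - walkPos s τ k)))) * (1 + f x) := by
          simp only [hcons, hstep]
          exact Finset.sum_congr rfl fun a _ => Finset.sum_comm
      _ = _ := by
          simp only [← Finset.sum_mul, ih, ← Finset.mul_sum]
          rw [expProd, walkOp_apply, Fintype.sum_prod_type]
          simp only [Fintype.card_prod, Nat.cast_mul]
          rw [mul_add 2, pow_add]
          field_simp

end Positions

/-! ### The second moment method for oriented shielded paths -/

section SecondMoment

variable {d : ℕ}

open Classical in
/-- The second moment method for the number of the events `closedEvent (S i)` that occur, each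
weighted by the inverse of its probability. -/
lemma card_sq_le_real_iUnion_closedEvent_mul {I : Type*} [Fintype I]
    (p : unitInterval) (hp : (p : ℝ) < 1) (S : I → Finset (latticeGraph d).edgeSet) :
    (Fintype.card I : ℝ) ^ 2 ≤ (bondPercolation d p).real (⋃ i, closedEvent (S i)) *
      ∑ i, ∑ j, ((1 - (p : ℝ))⁻¹) ^ (S i ∩ S j).card := by
  set μ := bondPercolation d p
  set q : ℝ := 1 - p with hq
  have hq0 : 0 < q := by linarith
  set U := ⋃ i, closedEvent (S i) with hU
  have hUm : MeasurableSet U := MeasurableSet.iUnion fun i => measurableSet_closedEvent (S i)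
  set X : Finset (latticeGraph d).edgeSet → BondConfig d → ℝ := fun T =>
    (closedEvent T).indicator 1 with hX
  have hXm : ∀ T, Integrable (X T) μ := fun T =>
    (integrable_const (1 : ℝ)).indicator (measurableSet_closedEvent T)
  have hXint : ∀ T, ∫ ω, X T ω ∂μ = q ^ T.card := fun T => by
    rw [hX, integral_indicator_one (measurableSet_closedEvent T), bondPercolation_real_closedEvent]
  have hXX : ∀ T T' ω, X T ω * X T' ω = X (T ∪ T') ω := by
    intro T T' ω
    have : closedEvent (T ∪ T') = closedEvent T ∩ closedEvent T' := by
      ext ω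
      change (∀ e ∈ T ∪ T', ω e = false) ↔ (∀ e ∈ T, ω e = false) ∧ ∀ e ∈ T', ω e = false
      simp only [Finset.mem_union, or_imp, forall_and]
    simp only [hX, this, Set.indicator_apply, Set.mem_inter_iff, Pi.one_apply]
    split_ifs <;> simp_all
  have hU0 : ∀ i ω, X (S i) ω * U.indicator 1 ω = X (S i) ω := by
    intro i ω
    by_cases h : ω ∈ closedEvent (S i)
    · rw [Set.indicator_of_mem (show ω ∈ U from Set.mem_iUnion_of_mem i h), Pi.one_apply, mul_one]
    · simp [hX, h]
  set c : I → ℝ := fun i => (q ^ (S i).card)⁻¹ with hc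
  have hquad : ∀ t : ℝ, 0 ≤ μ.real U * (t * t) + (-2 * Fintype.card I) * t +
      ∑ i, ∑ j, (q⁻¹) ^ (S i ∩ S j).card := by
    intro t
    have hexp : ∀ ω, (∑ i, c i * X (S i) ω - t * U.indicator 1 ω) ^ 2 =
        t * t * U.indicator 1 ω + (-2 * t) * (∑ i, c i * X (S i) ω) +
          ∑ i, ∑ j, c i * c j * X (S i ∪ S j) ω := by
      intro ω
      have h1 : (∑ i, c i * X (S i) ω) ^ 2 = ∑ i, ∑ j, c i * c j * X (S i ∪ S j) ω := by
        rw [sq, Finset.sum_mul_sum]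
        refine Finset.sum_congr rfl fun i _ => Finset.sum_congr rfl fun j _ => ?_
        rw [← hXX]; ring
      have h2 : (∑ i, c i * X (S i) ω) * U.indicator 1 ω = ∑ i, c i * X (S i) ω := by
        rw [Finset.sum_mul]
        refine Finset.sum_congr rfl fun i _ => ?_
        rw [mul_assoc, hU0]
      have h3 : U.indicator (1 : BondConfig d → ℝ) ω ^ 2 = U.indicator 1 ω := by
        by_cases h : ω ∈ U <;> simp [h]
      rw [sub_sq, mul_pow, h1, h3]
      linear_combination (-2 * t) * h2
    have hI1 : Integrable (fun ω => ∑ i, c i * X (S i) ω) μ :=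
      integrable_finsetSum _ fun i _ => (hXm _).const_mul _
    have hI2 : Integrable (fun ω => ∑ i, ∑ j, c i * c j * X (S i ∪ S j) ω) μ :=
      integrable_finsetSum _ fun i _ => integrable_finsetSum _ fun j _ => (hXm _).const_mul _
    have hI0 : Integrable (U.indicator (1 : BondConfig d → ℝ)) μ :=
      (integrable_const (1 : ℝ)).indicator hUm
    have hI3 : Integrable (fun ω => t * t * U.indicator 1 ω + 
        (-2 * t) * (∑ i, c i * X (S i) ω)) μ :=
      (hI0.const_mul _).add (hI1.const_mul _)
    have hint : ∫ ω, (∑ i, c i * X (S i) ω - t * U.indicator 1 ω) ^ 2 ∂μ =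
        μ.real U * (t * t) + (-2 * Fintype.card I) * t +
          ∑ i, ∑ j, (q⁻¹) ^ (S i ∩ S j).card := by
      simp only [hexp]
      rw [integral_add hI3 hI2,
        integral_add (hI0.const_mul _) (hI1.const_mul _), integral_const_mul, integral_const_mul,
        integral_indicator_one hUm, integral_finsetSum _ fun i _ => (hXm _).const_mul _,
        integral_finsetSum _ fun i _ => integrable_finsetSum _ fun j _ => (hXm _).const_mul _]
      congr 1
      · simp only [integral_const_mul, hXint, hc]
        simp only [inv_mul_cancel₀ (pow_ne_zero _ hq0.ne')]
        simp
        ring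
      · refine Finset.sum_congr rfl fun i _ => ?_
        rw [integral_finsetSum _ fun j _ => (hXm _).const_mul _]
        refine Finset.sum_congr rfl fun j _ => ?_
        rw [integral_const_mul, hXint, hc, inv_pow]
        have := Finset.card_union_add_card_inter (S i) (S j)
        have h4 : q ^ (S i).card * q ^ (S j).card =
            q ^ (S i ∪ S j).card * q ^ (S i ∩ S j).card := by rw [← pow_add, ← pow_add, this]
        field_simp
        linarith
    rw [← hint]
    exact integral_nonneg fun ω => sq_nonneg _
  have := discrim_le_zero hquad
  rw [discrim] at this
  nlinarith

variable {n : ℕ} {δ : Type*}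

open Classical in
/-- The edges incident to the vertices of an oriented path. -/
noncomputable def pathEdges (ι : δ ↪ Fin d) (σ : Fin n → δ) : Finset (latticeGraph d).edgeSet :=
  (Finset.range (n + 1)).biUnion fun k => incidentEdges (walkPos (orientedStep ι) σ k)

lemma mem_pathEdges {ι : δ ↪ Fin d} {σ : Fin n → δ} {e : (latticeGraph d).edgeSet} :
    e ∈ pathEdges ι σ ↔ ∃ k ≤ n, walkPos (orientedStep ι) σ k ∈ (e : Sym2 (Fin d → ℤ)) := by
  classical
  simp [pathEdges, mem_incidentEdges]

/-- An edge touching two oriented paths at time `i` and time `j` has `|i - j| ≤ 1`; it is charged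
to the time `min i j`. -/
lemma pow_card_pathEdges_inter_le [DecidableEq (latticeGraph d).edgeSet] (ι : δ ↪ Fin d)
    (σ τ : Fin n → δ) {B : ℝ} (hB : 1 ≤ B) :
    B ^ (pathEdges ι σ ∩ pathEdges ι τ).card ≤
      ∏ k ∈ Finset.range (n + 1), (1 + overlapWeight (B ^ (2 * d + 2)) (B ^ 2 - 1)
        (walkPos (orientedStep ι) σ k - walkPos (orientedStep ι) τ k)) := by
  classical
  set x := walkPos (orientedStep ι) σ with hx
  set y := walkPos (orientedStep ι) τ with hy
  let R : (Fin d → ℤ) → Prop := fun z => ∃ i j : Fin d, z = Pi.single i 1 - Pi.single j 1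
  let A : ℕ → Finset (Sym2 (Fin d → ℤ)) := fun k =>
    if x k - y k = 0 then (incidentEdges (x k)).map (Function.Embedding.subtype _) else ∅
  let C : ℕ → Finset (Sym2 (Fin d → ℤ)) := fun k =>
    if R (x k - y k) then {s(x k, y (k + 1)), s(x (k + 1), y k)} else ∅
  let m : ℕ → ℕ := fun k => (if x k - y k = 0 then 2 * d else 0) + if R (x k - y k) then 2 else 0
  have hsub : (pathEdges ι σ ∩ pathEdges ι τ).map (Function.Embedding.subtype _) ⊆
      (Finset.range (n + 1)).biUnion fun k => A k ∪ C k := by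
    intro e he
    obtain ⟨e, he', rfl⟩ := Finset.mem_map.1 he
    obtain ⟨hσ, hτ⟩ := Finset.mem_inter.1 he'
    obtain ⟨i, hi, hei⟩ := mem_pathEdges.1 hσ
    obtain ⟨j, hj, hej⟩ := mem_pathEdges.1 hτ
    have hsi : ∑ l, x i l = i := sum_walkPos ι σ hi
    have hsj : ∑ l, y j l = j := sum_walkPos ι τ hj
    rw [Finset.mem_biUnion]
    by_cases hxy : x i = y j
    · have hij : i = j := by
        have : (i : ℤ) = j := by rw [← hsi, ← hsj, hxy]
        exact_mod_cast this
      subst hij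
      refine ⟨i, by simpa [Nat.lt_succ_iff] using hi, Finset.mem_union_left _ ?_⟩
      simp only [A, hxy, sub_self, if_true]
      exact Finset.mem_map_of_mem _ (mem_incidentEdges.2 hej)
    · have he2 : (e : Sym2 (Fin d → ℤ)) = s(x i, y j) := (Sym2.mem_and_mem_iff hxy).1 ⟨hei, hej⟩
      have hadj : (latticeGraph d).Adj (x i) (y j) := by
        rw [← SimpleGraph.mem_edgeSet, ← he2]; exact e.2
      obtain ⟨⟨l, b⟩, hl⟩ := adj_iff_exists_unitStep.1 hadj
      have hs : (j : ℤ) = i + if b then 1 else -1 := by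
        rw [← hsi, ← hsj, hl]
        simp [Finset.sum_add_distrib, unitStep]
      cases b
      · obtain rfl : i = j + 1 := by simp at hs; omega
        refine ⟨j, by simpa [Nat.lt_succ_iff] using hj, Finset.mem_union_right _ ?_⟩
        have hR : R (x j - y j) := by
          refine ⟨l, ι (σ ⟨j, hi⟩), ?_⟩
          rw [hl, hx, walkPos_succ _ σ hi]
          simp only [unitStep, orientedStep, Bool.false_eq_true, if_false, Pi.single_neg]
          abel
        simp [C, hR, he2]
      · obtain rfl : j = i + 1 := by simp at hs; omega
        refine ⟨i, by simpa [Nat.lt_succ_iff] using hi, Finset.mem_union_right _ ?_⟩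
        have hR : R (x i - y i) := by
          refine ⟨ι (τ ⟨i, hj⟩), l, ?_⟩
          have h := walkPos_succ (orientedStep ι) τ hj
          rw [← hy, hl] at h
          simp only [unitStep, orientedStep, if_true] at h
          linear_combination (exp := 1) h
        simp [C, hR, he2]
  have hcard : (pathEdges ι σ ∩ pathEdges ι τ).card ≤ ∑ k ∈ Finset.range (n + 1), m k := by
    rw [← Finset.card_map (Function.Embedding.subtype _)]
    refine (Finset.card_le_card hsub).trans (Finset.card_biUnion_le.trans
      (Finset.sum_le_sum fun k _ => (Finset.card_union_le _ _).trans (add_le_add ?_ ?_)))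
    · simp only [A]
      split_ifs <;> simp [card_incidentEdges]
    · simp only [C]
      split_ifs
      · exact Finset.card_le_two
      · simp
  refine (pow_le_pow_right₀ hB hcard).trans ?_
  rw [← Finset.prod_pow_eq_pow_sum]
  refine Finset.prod_le_prod (fun _ _ => by positivity) fun k _ => ?_
  have hB2 : 1 ≤ B ^ 2 := one_le_pow₀ hB
  simp only [m, overlapWeight, R]
  split_ifs
  · linarith
  · have := pow_le_pow_right₀ hB (by omega : 2 * d + 0 ≤ 2 * d + 2)
    linarith
  · simp
  · simp

end SecondMoment

section Existence

variable {d D : ℕ} {δ : Type*}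

lemma walkPos_restrict (ι : δ ↪ Fin d) (s : ℕ → δ) {n k : ℕ} (hk : k ≤ n) :
    walkPos (orientedStep ι) (fun i : Fin n => s i) k =
      ∑ i ∈ Finset.range k, orientedStep ι (s i) := by
  induction k with
  | zero => simp
  | succ k ih => rw [walkPos_succ _ _ hk, ih (Nat.le_of_succ_le hk), Finset.sum_range_succ]

lemma sum_sum_orientedStep (ι : δ ↪ Fin d) (s : ℕ → δ) (k : ℕ) :
    ∑ l, (∑ i ∈ Finset.range k, orientedStep ι (s i)) l = k := by
  rw [← walkPos_restrict ι s le_rfl, sum_walkPos ι _ le_rfl]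

/-- By compactness, there is an infinite oriented shielded path if there are arbitrarily long
finite ones. -/
lemma exists_isInfiniteShieldedPath [Finite δ] (ι : δ ↪ Fin d) {ω : BondConfig d}
    (h : ∀ n, ∃ s : ℕ → δ, ∀ k ∈ Finset.range (n + 1),
      IsShielded ω (∑ i ∈ Finset.range k, orientedStep ι (s i))) :
    ∃ γ, IsInfiniteShieldedPath ω γ := by
  let _ : TopologicalSpace δ := ⊥
  have _ : DiscreteTopology δ := ⟨rfl⟩
  let C : ℕ → Set (ℕ → δ) := fun n => {s | ∀ k ∈ Finset.range (n + 1),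
    IsShielded ω (∑ i ∈ Finset.range k, orientedStep ι (s i))}
  have hclosed : ∀ n, IsClosed (C n) := by
    intro n
    have hC : C n = ⋂ k ∈ Finset.range (n + 1),
        {s | IsShielded ω (∑ i ∈ Finset.range k, orientedStep ι (s i))} := by
      ext s; simp [C]
    rw [hC]
    refine isClosed_biInter fun k _ => ?_
    let g : (Fin k → δ) → Prop := fun t => IsShielded ω (∑ i, orientedStep ι (t i))
    have : {s : ℕ → δ | IsShielded ω (∑ i ∈ Finset.range k, orientedStep ι (s i))} =
        (fun (s : ℕ → δ) (i : Fin k) => s i) ⁻¹' {t | g t} := by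
      ext s
      simp [g, Finset.sum_range]
    rw [this]
    exact (isClosed_discrete _).preimage (by fun_prop)
  obtain ⟨s, hs⟩ := IsCompact.nonempty_iInter_of_sequence_nonempty_isCompact_isClosed C
    (fun n s hs k hk => hs k (Finset.range_subset_range.2 (by omega) hk)) h
    (hclosed 0).isCompact hclosed
  refine ⟨fun k => ∑ i ∈ Finset.range k, orientedStep ι (s i), ?_, ?_, ?_⟩
  · intro k l hkl
    have := congrArg (fun v : Fin d → ℤ => ∑ i, v i) hkl
    simp only [sum_sum_orientedStep] at this
    exact_mod_cast this
  · intro k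
    refine adj_iff_exists_unitStep.2 ⟨(ι (s k), true), ?_⟩
    rw [Finset.sum_range_succ]
    rfl
  · exact fun k => Set.mem_iInter.1 hs k k (by simp)

/-- The existence of an infinite shielded path has positive probability as soon as the second
moments of the numbers of oriented shielded paths are under control. -/
lemma bondPercolation_exists_path_pos [NeZero D] (hD : 256 * D ≤ d) (p : unitInterval)
    (hp : (p : ℝ) < 1) {a c : ℝ} (ha : ((1 - (p : ℝ))⁻¹) ^ (2 * d + 2) = a)
    (hc : ((1 - (p : ℝ))⁻¹) ^ 2 - 1 = c)
    (h : a / (256 * D) + c + 16 * (a + c * d ^ 2) / (256 * D : ℝ) ^ 2 ≤ 1 / 2) :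
    0 < bondPercolation d p {ω | ∃ γ, IsInfiniteShieldedPath ω γ} := by
  classical
  set δ := Fin D × (Fin 8 → Bool)
  obtain ⟨ι⟩ : Nonempty (δ ↪ Fin d) := Function.Embedding.nonempty_of_card_le (by
    simp [δ]; omega)
  set B : ℝ := (1 - (p : ℝ))⁻¹ with hBdef
  have hB : 1 ≤ B := (one_le_inv₀ (by linarith)).2 (by linarith [p.2.1])
  have ha0 : 0 ≤ a := by rw [← ha]; positivity
  have hc0 : 0 ≤ c := by rw [← hc]; linarith [one_le_pow₀ hB (n := 2)]
  set κ : ℝ := (2 * (1 + overlapWeight (d := d) a c 0))⁻¹ with hκ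
  have hw0 : 0 ≤ overlapWeight (d := d) a c 0 := overlapWeight_nonneg ha0 hc0 0
  have hκ0 : 0 < κ := by positivity
  set μ := bondPercolation d p
  let E : ℕ → Set (BondConfig d) := fun n => {ω | ∃ s : ℕ → δ, ∀ k ∈ Finset.range (n + 1),
      IsShielded ω (∑ i ∈ Finset.range k, orientedStep ι (s i))}
  have hE : ∀ n, E n = ⋃ σ : Fin n → δ, closedEvent (pathEdges ι σ) := by
    intro n
    ext ω
    simp only [E, Set.mem_iUnion, pathEdges, Set.mem_ofPred_eq, ← forall_isShielded_iff]
    constructor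
    · rintro ⟨s, hs⟩
      refine ⟨fun i => s i, fun k hk => ?_⟩
      rw [walkPos_restrict ι s (Nat.lt_succ_iff.1 (Finset.mem_range.1 hk))]
      exact hs k hk
    · rintro ⟨σ, hσ⟩
      let s : ℕ → δ := fun i => if hi : i < n then σ ⟨i, hi⟩ else Classical.arbitrary δ
      have hs : (fun i : Fin n => s i) = σ := by ext1 i; simp [s]
      refine ⟨s, fun k hk => ?_⟩
      rw [← walkPos_restrict ι s (Nat.lt_succ_iff.1 (Finset.mem_range.1 hk)), hs]
      exact hσ k hk
  have hEm : ∀ n, MeasurableSet (E n) := fun n => by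
    rw [hE]
    exact MeasurableSet.iUnion fun σ => measurableSet_closedEvent _
  have hEanti : Antitone E := fun m n hmn ω ⟨s, hs⟩ =>
    ⟨s, fun k hk => hs k (Finset.range_subset_range.2 (by omega) hk)⟩
  have hEκ : ∀ n, ENNReal.ofReal κ ≤ μ (E n) := by
    intro n
    rw [ENNReal.ofReal_le_iff_le_toReal (measure_ne_top _ _), ← measureReal_def, hE]
    have h1 := card_sq_le_real_iUnion_closedEvent_mul p hp fun σ : Fin n → δ => pathEdges ι σ
    have h2 : ∑ σ : Fin n → δ, ∑ τ : Fin n → δ, B ^ (pathEdges ι σ ∩ pathEdges ι τ).card ≤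
        (Fintype.card δ : ℝ) ^ (2 * n) * ((1 + overlapWeight (d := d) a c 0) * 2) := by
      calc _ ≤ ∑ σ : Fin n → δ, ∑ τ : Fin n → δ, ∏ k ∈ Finset.range (n + 1),
            (1 + overlapWeight a c
              (0 + (walkPos (orientedStep ι) σ k - walkPos (orientedStep ι) τ k))) := by
            refine Finset.sum_le_sum fun σ _ => Finset.sum_le_sum fun τ _ => ?_
            simp only [zero_add, ← ha, ← hc]
            exact pow_card_pathEdges_inter_le ι σ τ hB
        _ = _ := sum_sum_prod_eq_expProd _ _ n 0
        _ ≤ _ := by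
            gcongr
            exact expProd_le_two _ (overlapWeight_nonneg ha0 hc0)
              (fun n z => (sum_diffOp_pow_overlapWeight_le ι ha0 hc0 n z).trans h) n 0
    have h3 := h1.trans (mul_le_mul_of_nonneg_left h2 measureReal_nonneg)
    rw [Fintype.card_fun, Fintype.card_fin, Nat.cast_pow, ← pow_mul, mul_comm n 2] at h3
    have hN : 0 < (Fintype.card δ : ℝ) ^ (2 * n) := by
      have : 0 < Fintype.card δ := Fintype.card_pos
      positivity
    rw [hκ, inv_le_iff_one_le_mul₀ (by positivity)]
    refine le_of_mul_le_mul_left ?_ hN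
    linarith
  have hlim := tendsto_measure_iInter_atTop (μ := μ) (fun n => (hEm n).nullMeasurableSet) hEanti
    ⟨0, measure_ne_top _ _⟩
  have hpos : 0 < μ (⋂ n, E n) := (ENNReal.ofReal_pos.2 hκ0).trans_le
    (ge_of_tendsto hlim (Eventually.of_forall hEκ))
  refine hpos.trans_le (measure_mono fun ω hω => ?_)
  exact exists_isInfiniteShieldedPath ι fun n => Set.mem_iInter.1 hω n

end Existence

/-! ### The first moment method for induced shielded paths -/

section FirstMoment

/-- A shortest walk is an induced path. -/
lemma getVert_ne_and_eq_succ_of_adj {V : Type*} {G : SimpleGraph V} {u v : V} {w : G.Walk u v}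
    (hw : w.length = G.dist u v) {i j : ℕ} (hij : i < j) (hj : j ≤ w.length) :
    w.getVert i ≠ w.getVert j ∧ (G.Adj (w.getVert i) (w.getVert j) → j = i + 1) := by
  constructor
  · intro h
    have := SimpleGraph.dist_le ((w.take i).append ((w.drop j).copy h.symm rfl))
    simp [SimpleGraph.Walk.take_length, SimpleGraph.Walk.drop_length] at this
    omega
  · intro h
    have := SimpleGraph.dist_le ((w.take i).append (SimpleGraph.Walk.cons h (w.drop j)))
    simp [SimpleGraph.Walk.take_length, SimpleGraph.Walk.drop_length] at this
    omega

variable {d : ℕ}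

lemma abs_sub_le_length {G : SimpleGraph (Fin d → ℤ)} (hG : G ≤ latticeGraph d) {u v : Fin d → ℤ}
    (w : G.Walk u v) (i : Fin d) : |v i - u i| ≤ w.length := by
  induction w with
  | nil => simp
  | @cons a b c hab w ih =>
    have h : ∑ j, |a j - b j| = 1 := hG hab
    have h1 := Finset.single_le_sum (fun j _ => abs_nonneg (a j - b j)) (Finset.mem_univ i)
    have h2 := abs_sub_le (c i) (b i) (a i)
    rw [abs_sub_comm (b i)] at h2
    rw [SimpleGraph.Walk.length_cons]
    push_cast
    linarith

/-- The first `n + 1` vertices of `x` are shielded and form an induced path of `ℤ^d`. -/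
structure IsInducedShieldedPath (ω : BondConfig d) (n : ℕ) (x : ℕ → Fin d → ℤ) : Prop where
  adj : ∀ k < n, (latticeGraph d).Adj (x k) (x (k + 1))
  shielded : ∀ k ≤ n, IsShielded ω (x k)
  ne : ∀ i j, i < j → j ≤ n → x i ≠ x j
  eq_succ : ∀ i j, i < j → j ≤ n → (latticeGraph d).Adj (x i) (x j) → j = i + 1

/-- An infinite shielded path leaves all balls of the graph of shielded vertices, so its starting
point starts arbitrarily long shortest walks in that graph. -/
lemma exists_isInducedShieldedPath {ω : BondConfig d} {γ : ℕ → Fin d → ℤ}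
    (hγ : IsInfiniteShieldedPath ω γ) (n : ℕ) :
    ∃ x : ℕ → Fin d → ℤ, x 0 = γ 0 ∧ IsInducedShieldedPath ω n x := by
  let G : SimpleGraph (Fin d → ℤ) :=
    { Adj := fun x y => (latticeGraph d).Adj x y ∧ IsShielded ω x ∧ IsShielded ω y
      symm := ⟨fun x y h => ⟨h.1.symm, h.2.2, h.2.1⟩⟩
      loopless := ⟨fun x h => (latticeGraph d).loopless.irrefl x h.1⟩ }
  have hG : G ≤ latticeGraph d := fun x y h => h.1
  have hreach : ∀ m, G.Reachable (γ 0) (γ m) := by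
    intro m
    induction m with
    | zero => rfl
    | succ m ih =>
      exact ih.trans (SimpleGraph.Adj.reachable ⟨hγ.adj m, hγ.shielded m, hγ.shielded (m + 1)⟩)
  obtain ⟨m, hm⟩ : ∃ m, n ≤ G.dist (γ 0) (γ m) := by
    by_contra! hlt
    refine Set.infinite_range_of_injective hγ.injective
      ((Set.finite_Icc (fun i => γ 0 i - n) (fun i => γ 0 i + n)).subset ?_)
    rintro _ ⟨m, rfl⟩
    obtain ⟨w, hw⟩ := (hreach m).exists_walk_length_eq_dist
    have hwn : (w.length : ℤ) ≤ n := by have := hlt m; omega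
    have h := fun i => abs_le.1 ((abs_sub_le_length hG w i).trans hwn)
    exact ⟨fun i => by have := h i; simp only; linarith [this.1],
      fun i => by have := h i; simp only; linarith [this.2]⟩
  obtain ⟨w, hw⟩ := (hreach m).exists_walk_length_eq_dist
  rw [← hw] at hm
  have hsh : ∀ k ≤ n, IsShielded ω (w.getVert k) := by
    rintro (_ | k) hk
    · rw [w.getVert_zero]; exact hγ.shielded 0
    · exact (w.adj_getVert_succ (i := k) (by omega)).2.2
  refine ⟨w.getVert, w.getVert_zero, fun k hk => (w.adj_getVert_succ (by omega)).1, hsh,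
    fun i j hij hj => (getVert_ne_and_eq_succ_of_adj hw hij (hj.trans hm)).1,
    fun i j hij hj h => (getVert_ne_and_eq_succ_of_adj hw hij (hj.trans hm)).2
      ⟨h, hsh i (by omega), hsh j hj⟩⟩

open Classical in
/-- Consecutive vertices of an induced path share one edge, and other pairs of vertices share
none. -/
lemma le_card_biUnion_incidentEdges (hd : 1 ≤ d) {ω : BondConfig d} {n : ℕ}
    {x : ℕ → Fin d → ℤ} (hx : IsInducedShieldedPath ω n x) {m : ℕ} (hm : m ≤ n) :
    (2 * d - 1) * (m + 1) ≤ ((Finset.range (m + 1)).biUnion fun k => incidentEdges (x k)).card := by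
  induction m with
  | zero => simp [card_incidentEdges]
  | succ m ih =>
    set A := (Finset.range (m + 1)).biUnion fun k => incidentEdges (x k) with hA
    have hA' : ((Finset.range (m + 1 + 1)).biUnion fun k => incidentEdges (x k)) =
        A ∪ incidentEdges (x (m + 1)) := by
      rw [Finset.range_add_one, Finset.biUnion_insert, Finset.union_comm]
    have hmem : ∀ e ∈ A ∩ incidentEdges (x (m + 1)),
        (e : Sym2 (Fin d → ℤ)) = s(x m, x (m + 1)) := by
      intro e he
      obtain ⟨h1, h2⟩ := Finset.mem_inter.1 he
      obtain ⟨i, hi, hei⟩ := Finset.mem_biUnion.1 h1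
      have hi := Finset.mem_range.1 hi
      have he2 := (Sym2.mem_and_mem_iff (hx.ne i (m + 1) hi hm)).1
        ⟨mem_incidentEdges.1 hei, mem_incidentEdges.1 h2⟩
      have := hx.eq_succ i (m + 1) hi hm (by
        rw [← SimpleGraph.mem_edgeSet, ← he2]; exact e.2)
      obtain rfl : i = m := by omega
      exact he2
    have hle : (A ∩ incidentEdges (x (m + 1))).card ≤ 1 :=
      Finset.card_le_one.2 fun a ha b hb => Subtype.ext ((hmem a ha).trans (hmem b hb).symm)
    have hu := Finset.card_union_add_card_inter A (incidentEdges (x (m + 1)))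
    rw [card_incidentEdges] at hu
    rw [hA', mul_add_one]
    have := ih (by omega)
    omega

lemma exists_walkPos_eq {ω : BondConfig d} {n : ℕ} {x : ℕ → Fin d → ℤ}
    (hx : IsInducedShieldedPath ω n x) :
    ∃ c : Fin n → Fin d × Bool, ∀ k ≤ n, x k = x 0 + walkPos unitStep c k := by
  choose c hc using fun k : Fin n => adj_iff_exists_unitStep.1 (hx.adj k k.2)
  refine ⟨c, fun k hk => ?_⟩
  induction k with
  | zero => simp
  | succ k ih =>
    rw [walkPos_succ _ c hk, ← add_assoc, ← ih (by omega)]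
    exact hc ⟨k, hk⟩

/-- The union bound over the paths of length `n` from `v` with at least `(2d - 1)(n + 1)` incident
edges. -/
lemma real_exists_path_from_le (hd : 1 ≤ d) (p : unitInterval) (v : Fin d → ℤ) (n : ℕ) :
    (bondPercolation d p).real {ω | ∃ γ, IsInfiniteShieldedPath ω γ ∧ γ 0 = v} ≤
      (2 * d * (1 - (p : ℝ)) ^ (2 * d - 1)) ^ n := by
  classical
  have hq0 : 0 ≤ 1 - (p : ℝ) := by linarith [p.2.2]
  have hq1 : 1 - (p : ℝ) ≤ 1 := by linarith [p.2.1]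
  let S : (Fin n → Fin d × Bool) → Finset (latticeGraph d).edgeSet := fun c =>
    (Finset.range (n + 1)).biUnion fun k => incidentEdges (v + walkPos unitStep c k)
  let P : Finset (Fin n → Fin d × Bool) :=
    Finset.univ.filter fun c => (2 * d - 1) * (n + 1) ≤ (S c).card
  have hsub : {ω | ∃ γ, IsInfiniteShieldedPath ω γ ∧ γ 0 = v} ⊆ ⋃ c ∈ P, closedEvent (S c) := by
    rintro ω ⟨γ, hγ, rfl⟩
    obtain ⟨x, hx0, hx⟩ := exists_isInducedShieldedPath hγ n
    obtain ⟨c, hc⟩ := exists_walkPos_eq hx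
    rw [hx0] at hc
    have hS : S c = (Finset.range (n + 1)).biUnion fun k => incidentEdges (x k) :=
      Finset.biUnion_congr rfl fun k hk => by
        rw [hc k (Nat.lt_succ_iff.1 (Finset.mem_range.1 hk))]
    refine Set.mem_biUnion (x := c) ?_ ?_
    · simp only [P, Finset.coe_filter, Finset.mem_univ, true_and, Set.mem_ofPred_eq, hS]
      exact le_card_biUnion_incidentEdges hd hx le_rfl
    · rw [hS, ← forall_isShielded_iff]
      exact fun k hk => hx.shielded k (Nat.lt_succ_iff.1 (Finset.mem_range.1 hk))
  calc _ ≤ (bondPercolation d p).real (⋃ c ∈ P, closedEvent (S c)) :=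
        measureReal_mono hsub (measure_ne_top _ _)
    _ ≤ ∑ c ∈ P, (bondPercolation d p).real (closedEvent (S c)) :=
        measureReal_biUnion_finset_le _ _
    _ ≤ ∑ c ∈ P, (1 - (p : ℝ)) ^ ((2 * d - 1) * n) := by
        refine Finset.sum_le_sum fun c hc => ?_
        rw [bondPercolation_real_closedEvent]
        refine pow_le_pow_of_le_one hq0 hq1 (le_trans ?_ (Finset.mem_filter.1 hc).2)
        gcongr
        omega
    _ ≤ ∑ _c : Fin n → Fin d × Bool, (1 - (p : ℝ)) ^ ((2 * d - 1) * n) :=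
        Finset.sum_le_sum_of_subset_of_nonneg (Finset.subset_univ _) fun _ _ _ => by positivity
    _ = _ := by
        simp
        rw [pow_mul, ← mul_pow, mul_comm (d : ℝ) 2]

lemma bondPercolation_exists_path_eq_zero (hd : 1 ≤ d) (p : unitInterval)
    (h : 2 * d * (1 - (p : ℝ)) ^ (2 * d - 1) < 1) :
    bondPercolation d p {ω | ∃ γ, IsInfiniteShieldedPath ω γ} = 0 := by
  have hq0 : 0 ≤ 1 - (p : ℝ) := by linarith [p.2.2]
  have hU : {ω : BondConfig d | ∃ γ, IsInfiniteShieldedPath ω γ} =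
      ⋃ v, {ω | ∃ γ, IsInfiniteShieldedPath ω γ ∧ γ 0 = v} := by
    ext ω; simp
  rw [hU, measure_iUnion_null_iff]
  intro v
  rw [← measureReal_eq_zero_iff]
  refine le_antisymm (ge_of_tendsto (tendsto_pow_atTop_nhds_zero_of_lt_one (by positivity) h)
    (Eventually.of_forall fun n => real_exists_path_from_le hd p v n)) measureReal_nonneg

end FirstMoment

/-! ### Asymptotics in high dimension -/

section Asymptotics

lemma bddAbove_shieldedParameters (d : ℕ) : BddAbove {p : ℝ | ∃ hp : p ∈ Set.Icc (0 : ℝ) 1,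
    0 < bondPercolation d ⟨p, hp⟩ {ω | ∃ γ, IsInfiniteShieldedPath ω γ}} :=
  ⟨1, fun _ ⟨hp, _⟩ => hp.2⟩

lemma tendsto_log_natCast_atTop : Tendsto (fun d : ℕ => Real.log d) atTop atTop :=
  Real.tendsto_log_atTop.comp tendsto_natCast_atTop_atTop

lemma tendsto_log_div_natCast : Tendsto (fun d : ℕ => Real.log d / d) atTop (𝓝 0) :=
  Real.isLittleO_log_id_atTop.tendsto_div_nhds_zero.comp tendsto_natCast_atTop_atTop

lemma eventually_pShield_le {ε : ℝ} (hε : 0 < ε) :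
    ∀ᶠ d : ℕ in atTop, pShield d ≤ (1 + ε) * (Real.log d / (2 * d)) := by
  have h1 : Tendsto (fun d : ℕ => (1 + ε) * (1 - 1 / 2 * (1 / (d : ℝ)))) atTop
      (𝓝 ((1 + ε) * (1 - 1 / 2 * 0))) :=
    (tendsto_const_nhds.sub (tendsto_one_div_atTop_nhds_zero_nat.const_mul _)).const_mul _
  have h1' := h1.eventually_const_lt (by linarith : 1 + ε / 2 < (1 + ε) * (1 - 1 / 2 * 0))
  have h2 := tendsto_log_natCast_atTop.eventually_gt_atTop (Real.log 2 / (ε / 2))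
  filter_upwards [h1', h2, eventually_ge_atTop 1] with d hd1 hd2 hd
  have hd0 : (1 : ℝ) ≤ d := mod_cast hd
  have hlog : 0 ≤ Real.log d := Real.log_nonneg hd0
  refine Real.sSup_le ?_ (by positivity)
  rintro p ⟨hp, hpos⟩
  by_contra! hlt
  refine hpos.ne' (bondPercolation_exists_path_eq_zero hd ⟨p, hp⟩ ?_)
  rw [div_lt_iff₀ (by positivity)] at hd2
  have h3 : Real.log 2 + Real.log d < p * (2 * d - 1) := by
    calc Real.log 2 + Real.log d < (1 + ε / 2) * Real.log d := by linarith
      _ ≤ (1 + ε) * (1 - 1 / 2 * (1 / (d : ℝ))) * Real.log d := by gcongr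
      _ = (1 + ε) * (Real.log d / (2 * d)) * (2 * d - 1) := by field_simp
      _ ≤ p * (2 * d - 1) := mul_le_mul_of_nonneg_right hlt.le (by linarith)
  have h4 : (1 - p) ^ (2 * d - 1) ≤ Real.exp (-(p * (2 * d - 1))) := by
    have h5 : Real.exp (-(p * (2 * d - 1))) = Real.exp (-p) ^ (2 * d - 1) := by
      rw [← Real.exp_nat_mul, Nat.cast_sub (by omega)]
      congr 1
      push_cast
      ring
    rw [h5]
    exact pow_le_pow_left₀ (by linarith [hp.2]) (Real.one_sub_le_exp_neg p) _
  calc 2 * (d : ℝ) * (1 - p) ^ (2 * d - 1)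
      ≤ Real.exp (Real.log 2 + Real.log d) * Real.exp (-(p * (2 * d - 1))) := by
        rw [Real.exp_add, Real.exp_log two_pos, Real.exp_log (by positivity)]
        gcongr
    _ = Real.exp (Real.log 2 + Real.log d - p * (2 * d - 1)) := by rw [← Real.exp_add]; rfl
    _ < 1 := (Real.exp_lt_exp.2 (by linarith : _ < (0 : ℝ))).trans_eq Real.exp_zero

lemma eventually_le_pShield {ε : ℝ} (hε : 0 < ε) (hε1 : ε < 1) :
    ∀ᶠ d : ℕ in atTop, (1 - ε) * (Real.log d / (2 * d)) ≤ pShield d := by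
  set p : ℕ → ℝ := fun d => (1 - ε) * (Real.log d / (2 * d)) with hpdef
  have hp0 : Tendsto p atTop (𝓝 0) := by
    have h := tendsto_log_div_natCast.const_mul ((1 - ε) / 2)
    rw [mul_zero] at h
    refine h.congr fun d => ?_
    simp only [hpdef]
    rw [mul_comm 2 (d : ℝ), ← div_div]
    ring
  have hB : Tendsto (fun d => (1 - p d)⁻¹) atTop (𝓝 1) := by
    simpa using (tendsto_const_nhds.sub hp0).inv₀ (by norm_num : (1 : ℝ) - 0 ≠ 0)
  have hc : Tendsto (fun d => (1 - p d)⁻¹ ^ 2 - 1) atTop (𝓝 0) := by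
    simpa using (hB.pow 2).sub_const 1
  -- The weight of a meeting times its probability at the first step is at most `d^{-ε/2}`, up to a
  -- constant.
  have hexp : Tendsto (fun d : ℕ => Real.exp (-(ε / 2 * Real.log d))) atTop (𝓝 0) :=
    Real.tendsto_exp_neg_atTop_nhds_zero.comp
      (tendsto_log_natCast_atTop.const_mul_atTop (by positivity))
  have hexpo : Tendsto (fun d : ℕ => (1 - ε) * ((1 + 1 / (d : ℝ)) * (1 - p d)⁻¹)) atTop
      (𝓝 ((1 - ε) * ((1 + 0) * 1))) :=
    ((tendsto_one_div_atTop_nhds_zero_nat.const_add 1).mul hB).const_mul _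
  filter_upwards [hp0.eventually_lt_const (by norm_num : (0 : ℝ) < 1),
    hc.eventually_lt_const (by norm_num : (0 : ℝ) < 1 / 260),
    hexp.eventually_lt_const (by norm_num : (0 : ℝ) < 1 / 264),
    hexpo.eventually_lt_const (by linarith : (1 - ε) * ((1 + 0) * 1) < 1 - ε / 2),
    eventually_ge_atTop 512] with d hp1 hcd hexpd hexpod hd
  have hdR : (512 : ℝ) ≤ d := mod_cast hd
  have hlog : 0 ≤ Real.log d := Real.log_nonneg (by linarith)
  have hpn : 0 ≤ p d := mul_nonneg (by linarith) (by positivity)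
  refine le_csSup (bddAbove_shieldedParameters d) ⟨⟨hpn, hp1.le⟩, ?_⟩
  have : NeZero (d / 256) := ⟨by omega⟩
  refine bondPercolation_exists_path_pos (D := d / 256) (by omega) _ hp1 rfl rfl ?_
  change (1 - p d)⁻¹ ^ (2 * d + 2) / (256 * (d / 256 : ℕ)) + ((1 - p d)⁻¹ ^ 2 - 1) +
    16 * ((1 - p d)⁻¹ ^ (2 * d + 2) + ((1 - p d)⁻¹ ^ 2 - 1) * d ^ 2) /
      (256 * ((d / 256 : ℕ) : ℝ)) ^ 2 ≤ 1 / 2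
  have hq : 0 < 1 - p d := by linarith
  have hB1 : 1 ≤ (1 - p d)⁻¹ := (one_le_inv₀ hq).2 (by linarith)
  set c := (1 - p d)⁻¹ ^ 2 - 1 with hcdef
  have hc0 : 0 ≤ c := by linarith [one_le_pow₀ hB1 (n := 2)]
  have ha : (1 - p d)⁻¹ ^ (2 * d + 2) ≤ d * (1 / 264) := by
    have h1 : (1 - p d)⁻¹ ≤ Real.exp (p d * (1 - p d)⁻¹) := by
      have := Real.add_one_le_exp (p d * (1 - p d)⁻¹)
      have h2 : p d * (1 - p d)⁻¹ + 1 = (1 - p d)⁻¹ := by field_simp; ring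
      linarith
    calc (1 - p d)⁻¹ ^ (2 * d + 2) ≤ Real.exp (p d * (1 - p d)⁻¹) ^ (2 * d + 2) := by gcongr
      _ = Real.exp ((1 - ε) * ((1 + 1 / (d : ℝ)) * (1 - p d)⁻¹) * Real.log d) := by
        rw [← Real.exp_nat_mul]
        congr 1
        have : p d = (1 - ε) * (Real.log d / (2 * d)) := rfl
        generalize (1 - p d)⁻¹ = b
        rw [this]
        push_cast
        field_simp
      _ ≤ Real.exp ((1 - ε / 2) * Real.log d) := by gcongr
      _ = d * Real.exp (-(ε / 2 * Real.log d)) := by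
        conv_rhs => rw [← Real.exp_log (by linarith : (0 : ℝ) < d)]
        rw [← Real.exp_add, Real.log_exp]
        congr 1
        ring
      _ ≤ d * (1 / 264) := by gcongr
  set a := (1 - p d)⁻¹ ^ (2 * d + 2)
  have ha0 : 0 ≤ a := by positivity
  have hN : (d : ℝ) / 2 ≤ 256 * (d / 256 : ℕ) := by
    have : d ≤ 2 * (256 * (d / 256)) := by omega
    have : (d : ℝ) ≤ 2 * (256 * (d / 256 : ℕ)) := mod_cast this
    linarith
  have hd2 : (0 : ℝ) < d / 2 := by linarith
  calc a / (256 * (d / 256 : ℕ)) + c + 16 * (a + c * d ^ 2) / (256 * ((d / 256 : ℕ) : ℝ)) ^ 2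
      ≤ a / (d / 2) + c + 16 * (a + c * d ^ 2) / (d / 2) ^ 2 := by gcongr
    _ = a / d * (2 + 64 / d) + 65 * c := by field_simp; ring
    _ ≤ 1 / 264 * (2 + 64 / 1) + 65 * (1 / 260) := by
      have : a / d ≤ 1 / 264 := by
        rw [div_le_iff₀ (by linarith)]; linarith
      gcongr
      linarith
    _ ≤ 1 / 2 := by norm_num

end Asymptotics

end ShieldedPercolation

theorem corollary1 :
    Tendsto (fun d : ℕ => pShield d / (Real.log d / (2 * d))) atTop (𝓝 1) := by
  have hpos : ∀ᶠ d : ℕ in atTop, 0 < Real.log d / (2 * d) := by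
    filter_upwards [eventually_ge_atTop 2] with d hd
    have : (2 : ℝ) ≤ d := mod_cast hd
    have := Real.log_pos (by linarith : (1 : ℝ) < d)
    positivity
  refine tendsto_order.2 ⟨fun a ha => ?_, fun a ha => ?_⟩
  · set ε := min ((1 - a) / 2) (1 / 2) with hε
    have h1 : ε ≤ (1 - a) / 2 := min_le_left _ _
    have h2 : ε ≤ 1 / 2 := min_le_right _ _
    have h0 : 0 < ε := lt_min (by linarith) (by norm_num)
    filter_upwards [hpos, ShieldedPercolation.eventually_le_pShield h0 (by linarith)] with d hd h
    rw [← le_div_iff₀ hd] at h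
    linarith
  · filter_upwards [hpos, ShieldedPercolation.eventually_pShield_le
      (by linarith : 0 < (a - 1) / 2)] with d hd h
    rw [← div_le_iff₀ hd] at h
    linarith
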